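/- Let $T>0$. A locally bounded measure on $\mathbb{R}$ is a real (signed) function on the class of bounded Borel sets that is countably additive on the Borel subsets of every compact set; $|\mu|$ denotes its total variation. Consider families $(\mu_t)_{t\in[0,T]}$ of locally bounded measures on $\mathbb{R}$ such that $t\mapsto\mu_t(B)$ is measurable for every bounded Borel set $B$ and $t\mapsto|\mu_t|(K)$ belongs to $L^1[0,T]$ for every compact $K$; such a family defines the locally bounded measure $\mu=\mu_t(dx)\,dt$ on $\mathbb{R}\times[0,T]$. For a locally bounded measure $\nu$ on $\mathbb{R}$ and a Borel function $b\colon\mathbb{R}\to\mathbb{R}$, such a $\mu$ is a solution to the Cauchy problem $$\partial_t\mu+\mathrm{div}(b\mu)=0,\qquad \mu|_{t=0}=\nu,$$ if $\int_0^T\int_U|b|\,d|\mu_t|\,dt<\infty$ for every bounded open interval $U$ and, for every function $u$ that is continuous on $\mathbb{R}\times[0,T)$ along with its first order derivatives $\partial_tu$, $\partial_xu$ and satisfies $u(x,t)=0$ for $|x|>R$ with some $R$, the equality $$\int_{\mathbb{R}}u(x,t)\,\mu_t(dx)=\int_{\mathbb{R}}u(x,0)\,\nu(dx)+\int_0^t\int_{\mathbb{R}}\bigl[\partial_tu(x,s)+b(x)\,\partial_xu(x,s)\bigr]\,\mu_s(dx)\,ds$$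 holds for almost every $t\in[0,T]$. Let $b\colon\mathbb{R}\to\mathbb{R}$ be continuous with $|b(x)|\le C+C|x|$ for all $x$ and some number $C$, and let $b=g+f$, where $g$ is Lipschitz, $f\ge 0$, and $g(x)<0$ implies $f(x)=0$. Let $Z_f=\{x\colon f(x)=0\}$ and let $\partial Z_f$ be its boundary. Then, for every locally bounded measure $\nu$, the Cauchy problem has at most one solution in the class of measures $\mu=\mu_t(dx)\,dt$ of the above form with $|\mu_t|(\partial Z_f)=0$ for almost all $t\in[0,T]$: if $(\mu^1_t)$ and $(\mu^2_t)$ define two solutions in this class with the same initial value $\nu$, then $\mu^1_t=\mu^2_t$ for almost every $t\in[0,T]$. -/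

import Mathlib

open MeasureTheory Set
open scoped NNReal ENNReal

noncomputable section

/-- A locally bounded (signed) Borel measure on `ℝ`: a real function on the class of bounded Borel
sets that is countably additive on the Borel subsets of every compact set. As for Mathlib's vector
measures, the function is totalised by the value `0` on sets that are not bounded Borel sets,
so that equality of such measures is equality on the bounded Borel sets. -/
@[ext]
structure LocallyBoundedMeasure where
  /-- The underlying set function. -/
  toFun : Set ℝ → ℝ
  empty' : toFun ∅ = 0
  eq_zero' : ∀ A : Set ℝ, ¬ (MeasurableSet A ∧ Bornology.IsBounded A) → toFun A = 0
  hasSum' : ∀ A : ℕ → Set ℝ, (∀ i, MeasurableSet (A i)) → Pairwise (Function.onFun Disjoint A) →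
    Bornology.IsBounded (⋃ i, A i) → HasSum (fun i => toFun (A i)) (toFun (⋃ i, A i))

namespace LocallyBoundedMeasure

instance : CoeFun LocallyBoundedMeasure (fun _ => Set ℝ → ℝ) := ⟨toFun⟩

open Classical in
/-- The finite signed measure `A ↦ μ (A ∩ (n, n + 1])` on `ℝ`. -/
def piece (μ : LocallyBoundedMeasure) (n : ℤ) : SignedMeasure ℝ where
  measureOf' A := if MeasurableSet A then μ (A ∩ Ioc (n : ℝ) (n + 1)) else 0
  empty' := by simp [μ.empty']
  not_measurable' A hA := by simp [hA]
  m_iUnion' A hA hd := by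
    have hU : MeasurableSet (⋃ i, A i) := MeasurableSet.iUnion hA
    simp only [hA, hU, if_true, iUnion_inter]
    refine μ.hasSum' _ (fun i => (hA i).inter measurableSet_Ioc) ?_ ?_
    · exact fun i j hij => (hd hij).mono inter_subset_left inter_subset_left
    · exact (Metric.isBounded_Ioc (n : ℝ) (n + 1)).subset (iUnion_subset fun _ => inter_subset_right)

/-- The positive part `μ⁺` of the Jordan decomposition of `μ`, a locally finite measure. -/
def posPart (μ : LocallyBoundedMeasure) : Measure ℝ :=
  Measure.sum fun n : ℤ => (μ.piece n).toJordanDecomposition.posPart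

/-- The negative part `μ⁻` of the Jordan decomposition of `μ`, a locally finite measure. -/
def negPart (μ : LocallyBoundedMeasure) : Measure ℝ :=
  Measure.sum fun n : ℤ => (μ.piece n).toJordanDecomposition.negPart

/-- The total variation `|μ| = μ⁺ + μ⁻`. -/
def variation (μ : LocallyBoundedMeasure) : Measure ℝ :=
  μ.posPart + μ.negPart

/-- The integral `∫ u dμ = ∫ u dμ⁺ - ∫ u dμ⁻`, meaningful if `u` is `|μ|`-integrable. -/
def integral (μ : LocallyBoundedMeasure) (u : ℝ → ℝ) : ℝ :=
  (∫ x, u x ∂μ.posPart) - ∫ x, u x ∂μ.negPart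

end LocallyBoundedMeasure

/-- The family `(μ_t)`, `t ∈ [0, T]`, defines the locally bounded measure `μ = μ_t(dx) dt` on
`ℝ × [0, T]`: the function `t ↦ μ_t(B)` is (Lebesgue) measurable for every bounded Borel set `B`
and `t ↦ |μ_t|(K)` belongs to `L¹[0, T]` for every compact `K`.
Values of the family outside `[0, T]` play no role. -/
structure IsLocallyBoundedFamily (T : ℝ) (μ : ℝ → LocallyBoundedMeasure) : Prop where
  aemeasurable : ∀ B : Set ℝ, MeasurableSet B → Bornology.IsBounded B →
    AEMeasurable (fun t => μ t B) (volume.restrict (Icc 0 T))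
  integrableOn : ∀ K : Set ℝ, IsCompact K →
    IntegrableOn (fun t => ((μ t).variation K).toReal) (Icc 0 T) volume

/-- `u(x, t)` is continuous on `ℝ × [0, T)` along with its first order derivatives
`ut = ∂_t u` (one-sided at `t = 0`) and `ux = ∂_x u`, and `u(x, t) = 0` if `|x| > R`
for some `R`. -/
structure IsTestFunction (T : ℝ) (u ut ux : ℝ → ℝ → ℝ) : Prop where
  continuousOn : ContinuousOn (fun p : ℝ × ℝ => u p.1 p.2) (univ ×ˢ Ico 0 T)
  continuousOn_t : ContinuousOn (fun p : ℝ × ℝ => ut p.1 p.2) (univ ×ˢ Ico 0 T)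
  continuousOn_x : ContinuousOn (fun p : ℝ × ℝ => ux p.1 p.2) (univ ×ˢ Ico 0 T)
  hasDeriv_t : ∀ x, ∀ t ∈ Ico 0 T, HasDerivWithinAt (fun s => u x s) (ut x t) (Ico 0 T) t
  hasDeriv_x : ∀ x, ∀ t ∈ Ico 0 T, HasDerivAt (fun y => u y t) (ux x t) x
  vanishes : ∃ R : ℝ, ∀ x, ∀ t ∈ Ico 0 T, R < |x| → u x t = 0

/-- `μ = μ_t(dx) dt`, given by the family `(μ_t)`, `t ∈ [0, T]`, is a solution to the Cauchy problem
`∂_t μ + div(b μ) = 0`, `μ|_{t = 0} = ν` on `ℝ × [0, T]`. -/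
structure IsCauchySolution (T : ℝ) (b : ℝ → ℝ) (ν : LocallyBoundedMeasure)
    (μ : ℝ → LocallyBoundedMeasure) : Prop where
  family : IsLocallyBoundedFamily T μ
  measurable_drift : Measurable b
  /-- `b ∈ L¹(|μ|, U × [0, T])` for every ball `U`, where `|μ| = |μ_t|(dx) dt`. -/
  integrable_drift : ∀ c r : ℝ,
    ∫⁻ t in Icc 0 T, ∫⁻ x in Metric.ball c r, ‖b x‖ₑ ∂(μ t).variation < ∞
  weak_equation : ∀ u ut ux : ℝ → ℝ → ℝ, IsTestFunction T u ut ux →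
    ∀ᵐ t ∂(volume.restrict (Icc 0 T)),
      (μ t).integral (fun x => u x t) = ν.integral (fun x => u x 0) +
        ∫ s in (0 : ℝ)..t, (μ s).integral (fun x => ut x s + b x * ux x s)

end

/-! The proof is by duality. Suppose the backward equation ∂_t u + b ∂_x u = 0 with value φ at time
τ has approximate solutions u_n whose defects ∂_t u_n + b ∂_x u_n are bounded, live in one compact
set and tend to 0 off ∂Z_f. Testing both solutions with u_n cancels ν, and dominated convergence
removes the defects, since ∂Z_f is not charged.

The u_n (`exists_approximate_backward_solutions`) come from the positive fields a_n = |b| + ε_n,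
whose flows are explicit in dimension one: x ↦ Y(H x + s) with H' = 1/a_n and Y = H⁻¹. Where g ≥ 0
also b ≥ 0, and φ is transported by this flow; where g < 0, b = g < 0, and the reversed flow is
used. The cutoffs η_n of `exists_cutoff` glue the two; the gluing error carries the factor b η_n',
which is bounded because g η_n' is, and which tends to 0 pointwise.

Where b ≠ 0 the defect vanishes in the limit because b / a_n → ±1. Where b = 0, both f and g vanish;
at an interior point x of Z_f the field satisfies a_n ≤ ε_n + Λ|y - x| nearby, so the time to leave
a neighbourhood diverges logarithmically (`tendsto_escape_time`). The flow freezes at x, and the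
defect tends to a multiple of b(x) = 0. -/

open Filter Topology

/-! ### Explicit flow of a positive field on the line -/

section FlowCoordinates

variable {a H Y : ℝ → ℝ} {A B δ x : ℝ}

/-- `H` measures travel time along the field `a`, and the left side is the travel time ∫₀^δ dr / (A
+ B r) of the faster field `A + B r`. -/
theorem log_growth_le_sub (hA : 0 < A) (hB : 0 < B) (hδ : 0 ≤ δ) (ha : ∀ y, 0 < a y)
    (hH : ∀ y, HasDerivAt H (a y)⁻¹ y) (hgrow : ∀ y, |y - x| ≤ δ → a y ≤ A + B * |y - x|) :
    (Real.log (A + B * δ) - Real.log A) / B ≤ H (x + δ) - H x := by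
  have hpos : ∀ y, x ≤ y → 0 < A + B * (y - x) := fun y hy => by
    have := mul_nonneg hB.le (sub_nonneg.2 hy); linarith
  have hd : ∀ y, x ≤ y → HasDerivAt (fun y => H y - Real.log (A + B * (y - x)) / B)
      ((a y)⁻¹ - (A + B * (y - x))⁻¹) y := fun y hy => by
    have h1 : HasDerivAt (fun y => A + B * (y - x)) B y := by
      simpa using (((hasDerivAt_id y).sub_const x).const_mul B).const_add A
    have h2 := (hH y).sub ((h1.log (hpos y hy).ne').div_const B)
    rw [div_div_cancel_left' hB.ne'] at h2
    exact h2
  have hmono : MonotoneOn (fun y => H y - Real.log (A + B * (y - x)) / B) (Icc x (x + δ)) := by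
    refine monotoneOn_of_deriv_nonneg (convex_Icc _ _)
      (fun y hy => (hd y hy.1).continuousAt.continuousWithinAt)
      (fun y hy => (hd y (interior_subset hy).1).differentiableAt.differentiableWithinAt) ?_
    intro y hy
    have hy' := interior_subset hy
    rw [(hd y hy'.1).deriv, sub_nonneg]
    refine inv_anti₀ (ha y) ?_
    have h0 : |y - x| = y - x := abs_of_nonneg (sub_nonneg.2 hy'.1)
    have := hgrow y (by rw [h0]; linarith [hy'.2])
    rwa [h0] at this
  have := hmono (left_mem_Icc.2 (by linarith)) (right_mem_Icc.2 (by linarith))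
    (by linarith : x ≤ x + δ)
  simp only [sub_self, mul_zero, add_zero, add_sub_cancel_left] at this
  rw [sub_div]
  linarith

theorem log_growth_le_sub_left (hA : 0 < A) (hB : 0 < B) (hδ : 0 ≤ δ) (ha : ∀ y, 0 < a y)
    (hH : ∀ y, HasDerivAt H (a y)⁻¹ y) (hgrow : ∀ y, |y - x| ≤ δ → a y ≤ A + B * |y - x|) :
    (Real.log (A + B * δ) - Real.log A) / B ≤ H x - H (x - δ) := by
  have h := log_growth_le_sub (a := fun y => a (-y)) (H := fun y => -H (-y)) (x := -x) hA hB hδ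
    (fun y => ha _) (fun y => ?_) (fun y hy => ?_)
  · simp only [neg_add, neg_neg] at h
    rw [← sub_eq_add_neg] at h
    linarith
  · have := ((hH (-y)).comp y (hasDerivAt_neg y)).neg
    simp only [mul_neg, mul_one, neg_neg] at this
    exact this
  · have h0 : |y - -x| = |-y - x| := by rw [← abs_neg]; congr 1; ring
    rw [h0] at hy ⊢
    exact hgrow _ hy

theorem strictMono_of_inv_deriv (ha : ∀ y, 0 < a y) (hH : ∀ y, HasDerivAt H (a y)⁻¹ y) :
    StrictMono H :=
  strictMono_of_deriv_pos fun y => by rw [(hH y).deriv]; exact inv_pos.2 (ha y)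

/-- In time `s` the flow of `a` does not leave the ball of radius `δ`, if `a` is small there. -/
theorem abs_flow_sub_lt (hA : 0 < A) (hB : 0 < B) (hδ : 0 ≤ δ) (ha : ∀ y, 0 < a y)
    (hH : ∀ y, HasDerivAt H (a y)⁻¹ y) (hHY : ∀ y, H (Y y) = y)
    (hgrow : ∀ y, |y - x| ≤ δ → a y ≤ A + B * |y - x|) {s : ℝ}
    (hs : |s| < (Real.log (A + B * δ) - Real.log A) / B) : |Y (H x + s) - x| < δ := by
  have h1 := log_growth_le_sub hA hB hδ ha hH hgrow
  have h2 := log_growth_le_sub_left hA hB hδ ha hH hgrow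
  have hm := strictMono_of_inv_deriv ha hH
  obtain ⟨hs1, hs2⟩ := abs_lt.1 hs
  have h3 : H (Y (H x + s)) < H (x + δ) := by rw [hHY]; linarith
  have h4 : H (x - δ) < H (Y (H x + s)) := by rw [hHY]; linarith
  rw [abs_lt]
  constructor <;> linarith [hm.lt_iff_lt.1 h3, hm.lt_iff_lt.1 h4]

theorem tendsto_log_growth (A : ℝ) (hB : 0 < B) :
    Tendsto (fun δ => (Real.log (A + B * δ) - Real.log A) / B) atTop atTop := by
  refine Tendsto.atTop_div_const hB (tendsto_atTop_add_const_right _ _ ?_)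
  exact Real.tendsto_log_atTop.comp
    (tendsto_atTop_add_const_left _ _ (tendsto_id.const_mul_atTop hB))

/-- Separation of variables: `H` is a primitive of `1 / a`. Linear growth of `a` makes the travel
time to ±∞ infinite, so `H` is onto and the flow `Y (H x + s)` is global. -/
theorem exists_flow_coordinates (hA : 0 < A) (hB : 0 < B) (hac : Continuous a)
    (ha : ∀ y, 0 < a y) (hgrow : ∀ y, a y ≤ A + B * |y|) :
    ∃ H Y : ℝ → ℝ, (∀ y, HasDerivAt H (a y)⁻¹ y) ∧ (∀ y, HasDerivAt Y (a (Y y)) y) ∧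
      (∀ y, H (Y y) = y) ∧ ∀ y, Y (H y) = y := by
  let H : ℝ → ℝ := fun x => ∫ y in (0 : ℝ)..x, (a y)⁻¹
  have hH : ∀ y, HasDerivAt H (a y)⁻¹ y := fun y =>
    ((hac.inv₀ fun y => (ha y).ne').integral_hasStrictDerivAt 0 y).hasDerivAt
  have hm := strictMono_of_inv_deriv ha hH
  have hc : Continuous H := continuous_iff_continuousAt.2 fun y => (hH y).continuousAt
  have hg : ∀ δ y, |y - 0| ≤ δ → a y ≤ A + B * |y - 0| := fun δ y _ => by simpa using hgrow y
  have htop : Tendsto H atTop atTop := by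
    refine tendsto_atTop_mono' _ ?_ (tendsto_atTop_add_const_right _ (H 0) (tendsto_log_growth A hB))
    filter_upwards [eventually_ge_atTop 0] with δ hδ
    have := log_growth_le_sub hA hB hδ ha hH (hg δ)
    rw [zero_add] at this
    linarith
  have hbot : Tendsto H atBot atBot := by
    have : Tendsto (fun δ => -H (-δ)) atTop atTop := by
      refine tendsto_atTop_mono' _ ?_
        (tendsto_atTop_add_const_right _ (-H 0) (tendsto_log_growth A hB))
      filter_upwards [eventually_ge_atTop 0] with δ hδ
      have := log_growth_le_sub_left hA hB hδ ha hH (hg δ)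
      rw [zero_sub] at this
      linarith
    have h2 := tendsto_neg_atTop_atBot.comp (this.comp tendsto_neg_atBot_atTop)
    refine h2.congr fun y => ?_
    simp
  have hsurj : Function.Surjective H := hc.surjective htop hbot
  let e := hm.orderIsoOfSurjective H hsurj
  have h1 : ∀ y, H (e.symm y) = y := fun y => e.apply_symm_apply y
  refine ⟨H, e.symm, hH, fun y => ?_, h1, fun y => e.symm_apply_apply y⟩
  have := HasDerivAt.of_local_left_inverse (f := H) (g := e.symm) (a := y)
    e.symm.continuous.continuousAt (hH (e.symm y)) (inv_ne_zero (ha _).ne')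
    (Eventually.of_forall h1)
  simpa using this

end FlowCoordinates

/-! ### Cutoffs adapted to the sign of g -/

/-- Smooth cutoffs exhausting `{g < 0}`, whose derivatives are controlled by `1 / |g|`. -/
theorem exists_cutoff {g : ℝ → ℝ} {Λ : ℝ≥0} (hg : LipschitzWith Λ g) :
    ∃ (η η' : ℕ → ℝ → ℝ) (M : ℝ), (∀ n x, HasDerivAt (η n) (η' n x) x) ∧
      (∀ n, Continuous (η' n)) ∧ (∀ n x, η n x ∈ Icc (0 : ℝ) 1) ∧
      (∀ n x, |g x * η' n x| ≤ M) ∧ (∀ n x, 0 ≤ g x → η n x = 0 ∧ η' n x = 0) ∧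
      ∀ x, g x < 0 → ∀ᶠ n in atTop, η n x = 1 ∧ η' n x = 0 := by
  let θ := Real.smoothTransition
  have hθd : ∀ s, HasDerivAt θ (deriv θ s) s := fun s =>
    ((Real.smoothTransition.contDiff (n := 1)).differentiable (by simp) s).hasDerivAt
  have hθc : Continuous (deriv θ) :=
    (Real.smoothTransition.contDiff (n := 1)).continuous_deriv (by simp)
  have hθ0 : ∀ s < 0, deriv θ s = 0 := fun s hs => by
    have : θ =ᶠ[𝓝 s] fun _ => (0 : ℝ) := by
      filter_upwards [Iio_mem_nhds hs] with r hr using Real.smoothTransition.zero_of_nonpos (le_of_lt hr)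
    rw [this.deriv_eq]; simp
  have hθ1 : ∀ s, 1 < s → deriv θ s = 0 := fun s hs => by
    have : θ =ᶠ[𝓝 s] fun _ => (1 : ℝ) := by
      filter_upwards [Ioi_mem_nhds hs] with r hr using Real.smoothTransition.one_of_one_le (le_of_lt hr)
    rw [this.deriv_eq]; simp
  obtain ⟨D, hD⟩ := isCompact_Icc.exists_bound_of_continuousOn (hθc.continuousOn (s := Icc (0:ℝ) 1))
  have hD0 : 0 ≤ D := (norm_nonneg _).trans (hD 0 (by simp))
  have hgc := hg.continuous
  let k : ℕ → ℝ := fun n => n + 1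
  have hk : ∀ n, 0 < k n := fun n => by positivity
  -- The averaging width is so small that smoothing moves `k n * g` by at most 1/2.
  let h : ℕ → ℝ := fun n => 1 / (2 * k n * (Λ + 1))
  have hh : ∀ n, 0 < h n := fun n => by have := hk n; positivity
  have hΛh : ∀ n, k n * (Λ * h n) ≤ 1 / 2 := fun n => by
    have h1 : k n * (Λ * h n) = (Λ / (Λ + 1)) * (1 / 2) := by
      have := (hk n).ne'
      have h2 : (Λ : ℝ) + 1 ≠ 0 := by positivity
      simp only [h]; field_simp
    rw [h1]
    have : (Λ : ℝ) / (Λ + 1) ≤ 1 := by rw [div_le_one (by positivity)]; linarith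
    linarith
  have hglip : ∀ x y, |g x - g y| ≤ Λ * |x - y| := fun x y => by
    simpa [Real.dist_eq] using hg.dist_le_mul x y
  -- A sliding average of `g` is C¹, has derivative bounded by `Λ` and stays within `Λ * h n` of
  -- `g`.
  let G : ℕ → ℝ → ℝ := fun n x => (h n)⁻¹ * ∫ y in x..(x + h n), g y
  let G' : ℕ → ℝ → ℝ := fun n x => (h n)⁻¹ * (g (x + h n) - g x)
  have hG : ∀ n x, HasDerivAt (G n) (G' n x) x := fun n x => by
    have h0 : ∀ x, ∫ y in x..(x + h n), g y = (∫ y in (0:ℝ)..(x + h n), g y) - ∫ y in (0:ℝ)..x, g y :=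
      fun x => (intervalIntegral.integral_interval_sub_left (hgc.intervalIntegrable _ _)
        (hgc.intervalIntegrable _ _)).symm
    simp only [G, G', h0]
    refine HasDerivAt.const_mul _ (HasDerivAt.sub ?_ (hgc.integral_hasStrictDerivAt 0 x).hasDerivAt)
    exact ((hgc.integral_hasStrictDerivAt 0 (x + h n)).hasDerivAt).comp_add_const x (h n)
  have hG'c : ∀ n, Continuous (G' n) := fun n => by fun_prop
  have hG'b : ∀ n x, |G' n x| ≤ Λ := fun n x => by
    have := hglip (x + h n) x
    rw [add_sub_cancel_left, abs_of_pos (hh n)] at this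
    simp only [G']
    rw [abs_mul, abs_inv, abs_of_pos (hh n), inv_mul_le_iff₀ (hh n)]
    linarith
  have hGg : ∀ n x, |G n x - g x| ≤ Λ * h n := fun n x => by
    have h1 : G n x - g x = (h n)⁻¹ * ∫ y in x..(x + h n), (g y - g x) := by
      rw [intervalIntegral.integral_sub (hgc.intervalIntegrable _ _) (by simp)]
      have := (hh n).ne'
      simp only [G, intervalIntegral.integral_const, add_sub_cancel_left, smul_eq_mul]
      field_simp
    have h2 := intervalIntegral.norm_integral_le_of_norm_le_const (a := x) (b := x + h n)
      (f := fun y => g y - g x) (C := Λ * h n) (fun y hy => by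
        rw [uIoc_of_le (by linarith [hh n])] at hy
        refine (hglip y x).trans (mul_le_mul_of_nonneg_left ?_ Λ.2)
        rw [abs_of_pos (by linarith [hy.1])]; linarith [hy.2])
    rw [h1, abs_mul, abs_inv, abs_of_pos (hh n), inv_mul_le_iff₀ (hh n)]
    rw [add_sub_cancel_left, abs_of_pos (hh n), Real.norm_eq_abs] at h2
    linarith
  have hkG : ∀ n x, |k n * G n x - k n * g x| ≤ 1 / 2 := fun n x => by
    rw [← mul_sub, abs_mul, abs_of_pos (hk n)]
    exact (mul_le_mul_of_nonneg_left (hGg n x) (hk n).le).trans (hΛh n)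
  -- If g ≥ 0, the argument of θ is at most -1/2, so the cutoff and its derivative vanish. The
  -- derivative of θ lives on [0, 1], which forces |k g| ≤ 5/2; thus g absorbs the factor k produced
  -- by differentiation.
  refine ⟨fun n x => θ (-1 - k n * G n x), fun n x => deriv θ (-1 - k n * G n x) * (-(k n * G' n x)),
    5 / 2 * D * Λ, fun n x => ?_, fun n => ?_, fun n x => ?_, fun n x => ?_, fun n x hx => ?_,
    fun x hx => ?_⟩
  · have := ((hG n x).const_mul (k n)).const_sub (-1)
    exact (hθd _).comp x this
  · have : Continuous (G n) := continuous_iff_continuousAt.2 fun x => (hG n x).continuousAt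
    have := hG'c n
    fun_prop
  · exact ⟨Real.smoothTransition.nonneg _, Real.smoothTransition.le_one _⟩
  · obtain ⟨h1, h2⟩ := abs_le.1 (hkG n x)
    by_cases hs : -1 - k n * G n x ∈ Icc (0 : ℝ) 1
    · have hb : |k n * g x| ≤ 5 / 2 := by rw [abs_le]; constructor <;> linarith [hs.1, hs.2]
      have he : g x * (deriv θ (-1 - k n * G n x) * (-(k n * G' n x))) =
        -((k n * g x) * deriv θ (-1 - k n * G n x) * G' n x) := by ring
      rw [he, abs_neg, abs_mul, abs_mul]
      have := hD _ hs
      rw [Real.norm_eq_abs] at this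
      exact mul_le_mul (mul_le_mul hb this (abs_nonneg _) (by norm_num)) (hG'b n x) (abs_nonneg _)
        (by positivity)
    · have : deriv θ (-1 - k n * G n x) = 0 := by
        by_cases h0 : -1 - k n * G n x < 0
        · exact hθ0 _ h0
        · exact hθ1 _ (not_le.1 fun h3 => hs ⟨not_lt.1 h0, h3⟩)
      beta_reduce; rw [this]; simp; positivity
  · obtain ⟨h1, h2⟩ := abs_le.1 (hkG n x)
    have : -1 - k n * G n x < 0 := by linarith [mul_nonneg (hk n).le hx]
    exact ⟨Real.smoothTransition.zero_of_nonpos this.le, by simp [hθ0 _ this]⟩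
  · obtain ⟨m, hm⟩ := exists_nat_gt (5 / 2 / -g x)
    filter_upwards [eventually_ge_atTop m] with n hn
    obtain ⟨h1, h2⟩ := abs_le.1 (hkG n x)
    have h3 : 5 / 2 < k n * -g x := by
      rw [← div_lt_iff₀ (by linarith)]
      have : (m : ℝ) ≤ n := by exact_mod_cast hn
      simp only [k]; linarith
    have : 1 < -1 - k n * G n x := by linarith
    exact ⟨Real.smoothTransition.one_of_one_le this.le, by simp [hθ1 _ this]⟩

/-! ### Jordan parts and integrals of locally bounded measures -/

theorem iUnion_inter_Ioc_int (A : Set ℝ) : ⋃ n : ℤ, A ∩ Ioc (n : ℝ) (n + 1) = A := by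
  rw [← inter_iUnion, iUnion_Ioc_intCast, inter_univ]

theorem pairwise_disjoint_inter_Ioc_int (A : Set ℝ) :
    Pairwise (Function.onFun Disjoint fun n : ℤ => A ∩ Ioc (n : ℝ) (n + 1)) := fun _ _ hij =>
  (pairwise_disjoint_Ioc_intCast ℝ hij).mono inter_subset_right inter_subset_right

theorem isLocallyFiniteMeasure_add (m₁ m₂ : Measure ℝ) [IsLocallyFiniteMeasure m₁]
    [IsLocallyFiniteMeasure m₂] : IsLocallyFiniteMeasure (m₁ + m₂) := by
  refine ⟨fun x => ?_⟩
  obtain ⟨s, hs, hs'⟩ := m₁.finiteAt_nhds x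
  obtain ⟨r, hr, hr'⟩ := m₂.finiteAt_nhds x
  refine ⟨s ∩ r, inter_mem hs hr, ?_⟩
  rw [Measure.add_apply]
  exact ENNReal.add_lt_top.2 ⟨(measure_mono inter_subset_left).trans_lt hs',
    (measure_mono inter_subset_right).trans_lt hr'⟩

namespace LocallyBoundedMeasure

variable (μ : LocallyBoundedMeasure)

theorem piece_apply (n : ℤ) {A : Set ℝ} (hA : MeasurableSet A) :
    μ.piece n A = μ (A ∩ Ioc (n : ℝ) (n + 1)) := by
  classical
  change (if MeasurableSet A then μ (A ∩ Ioc (n : ℝ) (n + 1)) else 0) = _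
  rw [if_pos hA]

theorem posPart_sub_negPart_piece (n : ℤ) {A : Set ℝ} (hA : MeasurableSet A) :
    (μ.piece n).toJordanDecomposition.posPart.real A -
      (μ.piece n).toJordanDecomposition.negPart.real A = μ (A ∩ Ioc (n : ℝ) (n + 1)) := by
  rw [← piece_apply μ n hA, ← Measure.toSignedMeasure_sub_apply hA]
  conv_rhs => rw [← (μ.piece n).toSignedMeasure_toJordanDecomposition]
  rfl

/-- The Jordan parts are ± the piece restricted to the two Hahn sets, and the piece vanishes on
every measurable subset of `A`. Hence each unit interval sees only its own piece in the sums
defining the Jordan parts. -/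
theorem piece_parts_eq_zero (n : ℤ) {A : Set ℝ} (hA : MeasurableSet A)
    (hd : A ∩ Ioc (n : ℝ) (n + 1) = ∅) :
    (μ.piece n).toJordanDecomposition.posPart A = 0 ∧
      (μ.piece n).toJordanDecomposition.negPart A = 0 := by
  obtain ⟨i, hi₁, hi₂, hi₃, hp, hn⟩ := (μ.piece n).toJordanDecomposition_spec
  have h0 : ∀ j, MeasurableSet j → μ.piece n (j ∩ A) = 0 := fun j hj => by
    rw [piece_apply μ n (hj.inter hA), inter_assoc, hd, inter_empty, μ.empty']
  rw [hp, hn, SignedMeasure.toMeasureOfZeroLE_apply _ _ hi₁ hA,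
    SignedMeasure.toMeasureOfLEZero_apply _ _ hi₁.compl hA]
  simp [h0 i hi₁, h0 iᶜ hi₁.compl]

theorem variation_apply {A : Set ℝ} (hA : MeasurableSet A) :
    μ.variation A = ∑' n : ℤ, ((μ.piece n).toJordanDecomposition.posPart A +
      (μ.piece n).toJordanDecomposition.negPart A) := by
  rw [variation, Measure.add_apply, posPart, negPart, Measure.sum_apply _ hA,
    Measure.sum_apply _ hA, ENNReal.tsum_add]

theorem variation_Ioc_lt_top (m : ℤ) : μ.variation (Ioc (m : ℝ) (m + 1)) < ∞ := by
  rw [variation_apply μ measurableSet_Ioc, tsum_eq_single m]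
  · exact ENNReal.add_lt_top.2 ⟨measure_lt_top _ _, measure_lt_top _ _⟩
  · intro n hn
    obtain ⟨h1, h2⟩ := μ.piece_parts_eq_zero n (A := Ioc (m : ℝ) (m + 1)) measurableSet_Ioc
      (disjoint_iff_inter_eq_empty.1 (pairwise_disjoint_Ioc_intCast ℝ hn.symm))
    rw [h1, h2, add_zero]

instance : IsLocallyFiniteMeasure μ.variation := by
  refine ⟨fun x => ⟨Ioc ((⌈x⌉ - 1 : ℤ) : ℝ) ((⌈x⌉ - 1 : ℤ) + 1) ∪ Ioc (⌈x⌉ : ℝ) (⌈x⌉ + 1), ?_,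
    (measure_union_le _ _).trans_lt (ENNReal.add_lt_top.2
      ⟨μ.variation_Ioc_lt_top _, μ.variation_Ioc_lt_top _⟩)⟩⟩
  have h1 := Int.ceil_lt_add_one x
  have h2 := Int.le_ceil x
  refine mem_of_superset (Ioo_mem_nhds (a := (⌈x⌉ : ℝ) - 1) (b := ⌈x⌉ + 1) (by linarith)
    (by linarith)) fun y hy => ?_
  push_cast
  rcases le_or_gt y ⌈x⌉ with h | h
  · exact Or.inl ⟨hy.1, by linarith⟩
  · exact Or.inr ⟨h, hy.2.le⟩

theorem posPart_le_variation : μ.posPart ≤ μ.variation := Measure.le_add_right le_rfl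

theorem negPart_le_variation : μ.negPart ≤ μ.variation := Measure.le_add_left le_rfl

instance : IsLocallyFiniteMeasure μ.posPart :=
  Measure.isLocallyFiniteMeasure_of_le μ.posPart_le_variation

instance : IsLocallyFiniteMeasure μ.negPart :=
  Measure.isLocallyFiniteMeasure_of_le μ.negPart_le_variation

theorem posPart_sub_negPart {A : Set ℝ} (hA : MeasurableSet A) (hb : Bornology.IsBounded A) :
    μ.posPart.real A - μ.negPart.real A = μ A := by
  have key : ∀ m : ℤ → Measure ℝ, Measure.sum m A ≠ ∞ →
      HasSum (fun n => (m n).real A) ((Measure.sum m).real A) := fun m hm => by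
    rw [Measure.sum_apply _ hA] at hm
    rw [measureReal_def, Measure.sum_apply _ hA, ENNReal.tsum_toReal_eq (ENNReal.ne_top_of_tsum_ne_top hm)]
    exact ENNReal.hasSum_toReal hm
  have hp : μ.posPart A ≠ ∞ := hb.measure_lt_top.ne
  have hn : μ.negPart A ≠ ∞ := hb.measure_lt_top.ne
  have h1 : HasSum _ (μ.posPart.real A - μ.negPart.real A) := (key _ hp).sub (key _ hn)
  simp_rw [posPart_sub_negPart_piece μ _ hA] at h1
  -- Countable additivity is stated for sequences, so the unit cells are enumerated by ℕ.
  have h2 := μ.hasSum' (fun k : ℕ => A ∩ Ioc ((Equiv.intEquivNat.symm k : ℤ) : ℝ)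
      ((Equiv.intEquivNat.symm k : ℤ) + 1)) (fun i => hA.inter measurableSet_Ioc)
    (fun i j hij => pairwise_disjoint_inter_Ioc_int A (Equiv.intEquivNat.symm.injective.ne hij))
    (hb.subset (iUnion_subset fun _ => inter_subset_left))
  rw [Equiv.intEquivNat.symm.surjective.iUnion_comp (fun n : ℤ => A ∩ Ioc (n : ℝ) (n + 1)),
    iUnion_inter_Ioc_int] at h2
  exact h1.unique
    ((Equiv.hasSum_iff (f := fun n : ℤ => μ (A ∩ Ioc (n : ℝ) (n + 1))) Equiv.intEquivNat.symm).1 h2)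

theorem enorm_integral_le (u : ℝ → ℝ) : ‖μ.integral u‖ₑ ≤ ∫⁻ x, ‖u x‖ₑ ∂μ.variation := by
  rw [variation, lintegral_add_measure, integral]
  exact enorm_sub_le.trans
    (add_le_add (enorm_integral_le_lintegral_enorm _) (enorm_integral_le_lintegral_enorm _))

theorem integral_sub {u v : ℝ → ℝ} (hu : Integrable u μ.variation)
    (hv : Integrable v μ.variation) :
    μ.integral u - μ.integral v = μ.integral fun x => u x - v x := by
  have hp := μ.posPart_le_variation
  have hn := μ.negPart_le_variation
  simp only [integral]
  rw [MeasureTheory.integral_sub (hu.mono_measure hp) (hv.mono_measure hp),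
    MeasureTheory.integral_sub (hu.mono_measure hn) (hv.mono_measure hn)]
  ring

/-- Locally bounded measures are equal if they agree on smoothed indicators of intervals. -/
theorem ext_of_integral_eq {μ₁ μ₂ : LocallyBoundedMeasure}
    (h : ∀ (p q : ℚ) (k : ℕ),
      μ₁.integral (fun x => Real.smoothTransition (k * (x - p)) *
        Real.smoothTransition (k * (q - x))) =
      μ₂.integral fun x => Real.smoothTransition (k * (x - p)) *
        Real.smoothTransition (k * (q - x))) : μ₁ = μ₂ := by
  have hlim : ∀ (μ : LocallyBoundedMeasure) (p q : ℚ), Tendsto (fun k : ℕ =>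
      μ.integral fun x => Real.smoothTransition (k * (x - p)) * Real.smoothTransition (k * (q - x)))
      atTop (𝓝 (μ.posPart.real (Ioo (p : ℝ) q) - μ.negPart.real (Ioo (p : ℝ) q))) := by
    intro μ p q
    have key : ∀ (m : Measure ℝ) [IsLocallyFiniteMeasure m], Tendsto (fun k : ℕ =>
        ∫ x, Real.smoothTransition (k * (x - p)) * Real.smoothTransition (k * (q - x)) ∂m)
        atTop (𝓝 (m.real (Ioo (p : ℝ) q))) := by
      intro m _
      rw [← integral_indicator_one measurableSet_Ioo]
      have hzero : ∀ (k : ℕ) (x : ℝ), x ∉ Ioo (p : ℝ) q →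
          Real.smoothTransition (k * (x - p)) * Real.smoothTransition (k * (q - x)) = 0 := by
        intro k x hx
        by_cases h1 : (p : ℝ) < x
        · have h2 : (q : ℝ) ≤ x := not_lt.1 fun h => hx ⟨h1, h⟩
          rw [Real.smoothTransition.zero_of_nonpos (x := k * (q - x))
            (mul_nonpos_of_nonneg_of_nonpos (by positivity) (by linarith)), mul_zero]
        · rw [Real.smoothTransition.zero_of_nonpos (x := k * (x - p))
            (mul_nonpos_of_nonneg_of_nonpos (by positivity) (by linarith)), zero_mul]
      refine tendsto_integral_of_dominated_convergence ((Ioo (p : ℝ) q).indicator 1)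
        (fun k => ?_) ?_ (fun k => ae_of_all _ fun x => ?_) (ae_of_all _ fun x => ?_)
      · have := Real.smoothTransition.continuous
        exact Continuous.aestronglyMeasurable (by fun_prop)
      · exact (integrable_indicator_iff measurableSet_Ioo).2 (integrableOn_const measure_Ioo_lt_top.ne)
      · by_cases hx : x ∈ Ioo (p : ℝ) q
        · rw [indicator_of_mem hx, Pi.one_apply, Real.norm_of_nonneg
            (mul_nonneg (Real.smoothTransition.nonneg _) (Real.smoothTransition.nonneg _))]
          exact mul_le_one₀ (Real.smoothTransition.le_one _) (Real.smoothTransition.nonneg _)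
            (Real.smoothTransition.le_one _)
        · rw [hzero k x hx, indicator_of_notMem hx, norm_zero]
      · by_cases hx : x ∈ Ioo (p : ℝ) q
        · rw [indicator_of_mem hx]
          refine tendsto_const_nhds.congr' ?_
          have h1 : Tendsto (fun k : ℕ => (k : ℝ) * (x - p)) atTop atTop :=
            tendsto_natCast_atTop_atTop.atTop_mul_const (by linarith [hx.1])
          have h2 : Tendsto (fun k : ℕ => (k : ℝ) * (q - x)) atTop atTop :=
            tendsto_natCast_atTop_atTop.atTop_mul_const (by linarith [hx.2])
          filter_upwards [h1.eventually_ge_atTop 1, h2.eventually_ge_atTop 1] with k hk1 hk2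
          rw [Real.smoothTransition.one_of_one_le hk1, Real.smoothTransition.one_of_one_le hk2]
          simp
        · simp only [hzero _ x hx, indicator_of_notMem hx, tendsto_const_nhds]
    exact (key _).sub (key _)
  have hpos : ∀ p q : ℚ, μ₁.posPart.real (Ioo (p : ℝ) q) - μ₁.negPart.real (Ioo (p : ℝ) q) =
      μ₂.posPart.real (Ioo (p : ℝ) q) - μ₂.negPart.real (Ioo (p : ℝ) q) := fun p q =>
    tendsto_nhds_unique (hlim μ₁ p q) ((hlim μ₂ p q).congr fun k => (h p q k).symm)
  -- Moving negative parts across turns the identity into one between locally finite positive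
  -- measures, which rational open intervals determine.
  have hsum : μ₁.posPart + μ₂.negPart = μ₂.posPart + μ₁.negPart := by
    have := isLocallyFiniteMeasure_add μ₁.posPart μ₂.negPart
    have := isLocallyFiniteMeasure_add μ₂.posPart μ₁.negPart
    refine Real.measure_ext_Ioo_rat fun p q => ?_
    rw [← ENNReal.toReal_eq_toReal_iff' measure_Ioo_lt_top.ne measure_Ioo_lt_top.ne]
    simp only [Measure.add_apply]
    rw [ENNReal.toReal_add measure_Ioo_lt_top.ne measure_Ioo_lt_top.ne,
      ENNReal.toReal_add measure_Ioo_lt_top.ne measure_Ioo_lt_top.ne]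
    have := hpos p q
    simp only [measureReal_def] at this
    linarith
  ext A
  by_cases hA : MeasurableSet A ∧ Bornology.IsBounded A
  · rw [← posPart_sub_negPart μ₁ hA.1 hA.2, ← posPart_sub_negPart μ₂ hA.1 hA.2]
    have h1 := congrArg (fun m : Measure ℝ => (m A).toReal) hsum
    simp only [Measure.add_apply] at h1
    rw [ENNReal.toReal_add hA.2.measure_lt_top.ne hA.2.measure_lt_top.ne,
      ENNReal.toReal_add hA.2.measure_lt_top.ne hA.2.measure_lt_top.ne] at h1
    simp only [measureReal_def]
    linarith
  · rw [μ₁.eq_zero' A hA, μ₂.eq_zero' A hA]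

end LocallyBoundedMeasure

/-! ### Measurability in time and dominated convergence -/

/-- A family of measures with a.e. measurable masses of compact sets has, locally, a measurable
version. -/
theorem exists_measurable_restrict_Icc {ρ : Measure ℝ} {m : ℝ → Measure ℝ}
    [∀ t, IsLocallyFiniteMeasure (m t)] (hm : ∀ K, IsCompact K → AEMeasurable (fun t => m t K) ρ)
    (R : ℝ) : ∃ κ : ℝ → Measure ℝ, Measurable κ ∧ (∀ t, IsFiniteMeasure (κ t)) ∧
      ∀ᵐ t ∂ρ, κ t = (m t).restrict (Icc (-R) R) := by
  classical
  -- Rational half-lines form a countable generating π-system; `none` adds the total mass.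
  let S : Option ℚ → Set ℝ := fun i => i.elim univ fun q => Iic (q : ℝ)
  have hSm : ∀ i, MeasurableSet (S i) := fun i => by
    cases i
    · exact MeasurableSet.univ
    · exact measurableSet_Iic
  have hSc : ∀ i, IsCompact (S i ∩ Icc (-R) R) := fun i => by
    refine isCompact_Icc.inter_left ?_
    cases i
    · exact isClosed_univ
    · exact isClosed_Iic
  have hf : ∀ i, AEMeasurable (fun t => m t (S i ∩ Icc (-R) R)) ρ := fun i => hm _ (hSc i)
  let G := aeSeqSet hf fun _ _ => True
  have hG : MeasurableSet G := aeSeq.aeSeqSet_measurableSet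
  -- On `G`, a measurable set of full measure, all these countably many masses agree with their
  -- measurable versions.
  let κ : ℝ → Measure ℝ := fun t => if t ∈ G then (m t).restrict (Icc (-R) R) else 0
  have hfin : ∀ t, IsFiniteMeasure (κ t) := fun t => by
    by_cases ht : t ∈ G
    · simp only [κ, ht, if_true]
      exact ⟨by rw [Measure.restrict_apply_univ]; exact isCompact_Icc.measure_lt_top⟩
    · simp only [κ, ht, if_false]; infer_instance
  have hκ : ∀ i, Measurable fun t => κ t (S i) := fun i => by
    have : (fun t => κ t (S i)) = G.indicator ((hf i).mk _) := by
      ext t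
      by_cases ht : t ∈ G
      · simp only [κ, ht, if_true, indicator_of_mem]
        rw [aeSeq.mk_eq_fun_of_mem_aeSeqSet hf ht, Measure.restrict_apply (hSm i)]
      · simp [κ, ht]
    rw [this]
    exact (hf i).measurable_mk.indicator hG
  refine ⟨κ, ?_, hfin, ?_⟩
  · refine Measurable.measure_of_isPiSystem
      (BorelSpace.measurable_eq.trans Real.borel_eq_generateFrom_Iic_rat) Real.isPiSystem_Iic_rat ?_
      (hκ none)
    intro s hs
    simp only [mem_iUnion, mem_singleton_iff] at hs
    obtain ⟨q, rfl⟩ := hs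
    exact hκ (some q)
  · have h0 : ρ Gᶜ = 0 := aeSeq.measure_compl_aeSeqSet_eq_zero hf (by simp)
    have h1 : ∀ᵐ t ∂ρ, t ∈ G := by rw [ae_iff]; exact h0
    filter_upwards [h1] with t ht
    simp only [κ, ht, if_true]

theorem measurable_lintegral_of_measurable_measure {κ : ℝ → Measure ℝ} (hκ : Measurable κ)
    [∀ t, IsFiniteMeasure (κ t)] {F : ℝ → ℝ → ℝ≥0∞} (hF : Measurable (Function.uncurry F)) :
    Measurable fun t => ∫⁻ x, F t x ∂κ t := by
  have hu : Measurable fun t => κ t univ := Measure.measurable_coe MeasurableSet.univ |>.comp hκ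
  -- The masses of `κ t` need not be bounded in `t`; dividing by `1 + κ t univ` gives a finite
  -- kernel, and the factor is restored afterwards.
  let K : ProbabilityTheory.Kernel ℝ ℝ := ⟨fun t => (1 + κ t univ)⁻¹ • κ t, by
    refine Measure.measurable_of_measurable_coe _ fun s hs => ?_
    simp only [Measure.smul_apply, smul_eq_mul]
    exact (hu.const_add 1).inv.mul ((Measure.measurable_coe hs).comp hκ)⟩
  have hne : ∀ t, (1 + κ t univ) ≠ 0 := fun t => by simp
  have hnt : ∀ t, (1 + κ t univ) ≠ ∞ := fun t => by simp
  have hK : ProbabilityTheory.IsFiniteKernel K := ⟨1, ENNReal.one_lt_top, fun t => by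
    change ((1 + κ t univ)⁻¹ • κ t) univ ≤ 1
    rw [Measure.smul_apply, smul_eq_mul, ← ENNReal.div_eq_inv_mul]
    exact ENNReal.div_le_of_le_mul (by rw [one_mul]; exact le_add_self)⟩
  have h1 : Measurable fun t => (1 + κ t univ) * ∫⁻ x, F t x ∂K t :=
    (hu.const_add 1).mul hF.lintegral_kernel_prod_right
  convert h1 using 2 with t
  change _ = _ * ∫⁻ x, F t x ∂((1 + κ t univ)⁻¹ • κ t)
  rw [lintegral_smul_measure, smul_eq_mul, ← mul_assoc, ENNReal.mul_inv_cancel (hne t) (hnt t),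
    one_mul]

namespace IsLocallyBoundedFamily

variable {T : ℝ} {μ : ℝ → LocallyBoundedMeasure}

theorem aemeasurable_variation (h : IsLocallyBoundedFamily T μ) {K : Set ℝ} (hK : IsCompact K) :
    AEMeasurable (fun t => (μ t).variation K) (volume.restrict (Icc 0 T)) := by
  have := (h.integrableOn K hK).aestronglyMeasurable.aemeasurable.ennreal_ofReal
  refine this.congr (ae_of_all _ fun t => ?_)
  exact ENNReal.ofReal_toReal hK.measure_lt_top.ne

theorem lintegral_variation_lt_top (h : IsLocallyBoundedFamily T μ) {K : Set ℝ}
    (hK : IsCompact K) : ∫⁻ t in Icc 0 T, (μ t).variation K < ∞ := by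
  refine lt_of_eq_of_lt (lintegral_congr fun t => ?_) (h.integrableOn K hK).hasFiniteIntegral
  rw [← ofReal_norm, Real.norm_of_nonneg ENNReal.toReal_nonneg,
    ENNReal.ofReal_toReal hK.measure_lt_top.ne]

/-- Dominated convergence for the measure `|μ_t|(dx) dt`. -/
theorem tendsto_lintegral_zero (h : IsLocallyBoundedFamily T μ) {e : ℕ → ℝ → ℝ → ℝ} {D R : ℝ}
    (hm : ∀ n, Measurable (Function.uncurry (e n)))
    (hD : ∀ n, ∀ s ∈ Icc 0 T, ∀ x, ‖e n s x‖ ≤ D)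
    (hR : ∀ n, ∀ s ∈ Icc 0 T, ∀ x, x ∉ Icc (-R) R → e n s x = 0)
    (hlim : ∀ᵐ s ∂(volume.restrict (Icc 0 T)), ∀ᵐ x ∂(μ s).variation,
      Tendsto (fun n => e n s x) atTop (𝓝 0)) :
    Tendsto (fun n => ∫⁻ s in Icc 0 T, ∫⁻ x, ‖e n s x‖ₑ ∂(μ s).variation) atTop (𝓝 0) := by
  -- The outer limit needs the inner integrals to be a.e. measurable in s. Since `e n s` vanishes
  -- outside `Icc (-R) R`, the measurable version there suffices.
  obtain ⟨κ, hκ, hfin, hκe⟩ := exists_measurable_restrict_Icc (m := fun t => (μ t).variation)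
    (fun K hK => h.aemeasurable_variation hK) R
  have heq : ∀ n, ∀ s ∈ Icc 0 T, ∫⁻ x, ‖e n s x‖ₑ ∂(μ s).variation =
      ∫⁻ x in Icc (-R) R, ‖e n s x‖ₑ ∂(μ s).variation := fun n s hs => by
    rw [← lintegral_indicator measurableSet_Icc]
    refine lintegral_congr fun x => ?_
    by_cases hx : x ∈ Icc (-R) R
    · rw [indicator_of_mem hx]
    · rw [indicator_of_notMem hx, hR n s hs x hx, enorm_zero]
  have hmem : ∀ᵐ s ∂(volume.restrict (Icc 0 T)), s ∈ Icc 0 T := ae_restrict_mem measurableSet_Icc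
  have hbd : ∀ n, ∀ s ∈ Icc 0 T, ∀ x, ‖e n s x‖ₑ ≤ ENNReal.ofReal D := fun n s hs x => by
    rw [← ofReal_norm]; exact ENNReal.ofReal_le_ofReal (hD n s hs x)
  rw [← lintegral_zero (μ := volume.restrict (Icc 0 T))]
  refine tendsto_lintegral_of_dominated_convergence'
    (fun s => ENNReal.ofReal D * (μ s).variation (Icc (-R) R)) (fun n => ?_) (fun n => ?_) ?_ ?_
  · refine (measurable_lintegral_of_measurable_measure hκ
      (F := fun s x => ‖e n s x‖ₑ) (hm n).enorm).aemeasurable.congr ?_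
    filter_upwards [hmem, hκe] with s hs hs2
    rw [heq n s hs, hs2]
  · filter_upwards [hmem] with s hs
    rw [heq n s hs]
    exact (lintegral_mono fun x => hbd n s hs x).trans_eq (setLIntegral_const _ _)
  · rw [lintegral_const_mul' _ _ ENNReal.ofReal_ne_top]
    exact (ENNReal.mul_lt_top ENNReal.ofReal_lt_top
      (h.lintegral_variation_lt_top isCompact_Icc)).ne
  · filter_upwards [hmem, hlim] with s hs hl
    simp_rw [heq _ s hs]
    rw [← lintegral_zero (μ := (μ s).variation.restrict (Icc (-R) R))]
    refine tendsto_lintegral_of_dominated_convergence' (fun _ => ENNReal.ofReal D) (fun n => ?_)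
      (fun n => ae_of_all _ fun x => hbd n s hs x) ?_ ?_
    · exact ((hm n).comp measurable_prodMk_left).enorm.aemeasurable
    · rw [setLIntegral_const]
      exact (ENNReal.mul_lt_top ENNReal.ofReal_lt_top isCompact_Icc.measure_lt_top).ne
    · filter_upwards [ae_restrict_of_ae hl] with x hx
      simpa using hx.enorm

end IsLocallyBoundedFamily

/-! ### Approximate solutions of the backward equation -/

/-- The quantity is ∫₀^δ dr / (ε n + B r), which tends to the divergent integral ∫₀^δ dr / (B r): a
Lipschitz field is not left from its zero in finite time. -/
theorem tendsto_escape_time {ε : ℕ → ℝ} (hε : ∀ n, 0 < ε n) (hε0 : Tendsto ε atTop (𝓝 0))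
    {B δ : ℝ} (hB : 0 < B) (hδ : 0 < δ) :
    Tendsto (fun n => (Real.log (ε n + B * δ) - Real.log (ε n)) / B) atTop atTop := by
  refine Tendsto.atTop_div_const hB ?_
  have h1 : Tendsto (fun n => Real.log (ε n)) atTop atBot :=
    Real.tendsto_log_nhdsGT_zero.comp
      (tendsto_nhdsWithin_iff.2 ⟨hε0, Eventually.of_forall hε⟩)
  have h2 : Tendsto (fun n => Real.log (ε n + B * δ)) atTop (𝓝 (Real.log (0 + B * δ))) :=
    (hε0.add_const _).log (by positivity)
  exact h2.add_atTop (tendsto_neg_atBot_atTop.comp h1)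

/-- Approximate solutions `u n` of the backward equation `∂_t u + b ∂_x u = 0` with the value `φ` at
time `τ`: the defect is bounded and tends to zero off the boundary of `{f = 0}`. -/
theorem exists_approximate_backward_solutions {T : ℝ} {b g f : ℝ → ℝ} {C : ℝ}
    {Λ : ℝ≥0} (hb : Continuous b) (hgrowth : ∀ x, |b x| ≤ C + C * |x|)
    (hsum : ∀ x, b x = g x + f x) (hf : ∀ x, 0 ≤ f x) (hg : LipschitzWith Λ g)
    (hgf : ∀ x, g x < 0 → f x = 0) {φ φ' : ℝ → ℝ} (hφ : ∀ x, HasDerivAt φ (φ' x) x)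
    (hφ'c : Continuous φ') {R₀ : ℝ} (hR₀ : 0 ≤ R₀) (hφ0 : ∀ x, R₀ < |x| → φ x = 0) :
    ∃ R K D : ℝ, ∀ τ ∈ Icc 0 T, ∃ u ut ux : ℕ → ℝ → ℝ → ℝ,
      (∀ n, IsTestFunction T (u n) (ut n) (ux n)) ∧
      (∀ n t, Continuous fun x => u n x t) ∧
      (∀ n, ∀ t ∈ Icc 0 T, ∀ x, x ∉ Icc (-R) R → u n x t = 0 ∧ φ x = 0) ∧
      (∀ n, ∀ t x, |u n x t - φ x| ≤ K * |τ - t|) ∧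
      (∀ n, Measurable (Function.uncurry fun t x => ut n x t + b x * ux n x t)) ∧
      (∀ n, ∀ t ∈ Icc 0 T, ∀ x, x ∉ Icc (-R) R → ut n x t + b x * ux n x t = 0) ∧
      (∀ n, ∀ t ∈ Icc 0 T, ∀ x, ‖ut n x t + b x * ux n x t‖ ≤ D) ∧
      ∀ t ∈ Icc 0 T, ∀ x, x ∉ frontier {x | f x = 0} →
        Tendsto (fun n => ut n x t + b x * ux n x t) atTop (𝓝 0) := by
  obtain ⟨η, η', M, hη, hη'c, hη01, hM, hηpos, hηneg⟩ := exists_cutoff hg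
  have hηc : ∀ n, Continuous (η n) := fun n =>
    continuous_iff_continuousAt.2 fun x => (hη n x).continuousAt
  have hφc : Continuous φ := continuous_iff_continuousAt.2 fun x => (hφ x).continuousAt
  have hC : 0 ≤ C := (abs_nonneg _).trans ((hgrowth 0).trans_eq (by simp))
  have hφ'0 : ∀ x, R₀ < |x| → φ' x = 0 := fun x hx => by
    have h1 : φ =ᶠ[𝓝 x] fun _ => (0 : ℝ) := by
      filter_upwards [(isOpen_lt continuous_const continuous_abs).mem_nhds hx] with y hy
      exact hφ0 y hy
    exact (hφ x).unique ((hasDerivAt_const x (0 : ℝ)).congr_of_eventuallyEq h1)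
  have hbound : ∀ h : ℝ → ℝ, Continuous h → (∀ x, R₀ < |x| → h x = 0) →
      ∃ c, 0 ≤ c ∧ ∀ x, |h x| ≤ c := fun h hc h0 => by
    obtain ⟨c, hc⟩ := isCompact_Icc.exists_bound_of_continuousOn (hc.continuousOn (s := Icc (-R₀) R₀))
    have hc0 : 0 ≤ c := (norm_nonneg _).trans (hc 0 ⟨by linarith, hR₀⟩)
    refine ⟨c, hc0, fun x => ?_⟩
    by_cases hx : R₀ < |x|
    · rw [h0 x hx]; simpa using hc0
    · exact hc x (abs_le.1 (not_lt.1 hx))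
  obtain ⟨L, hL0, hL⟩ := hbound φ hφc hφ0
  -- As ε ≤ 1, this `K` bounds |φ'| (|b| + ε), the rate at which φ changes along every flow below.
  obtain ⟨K, hK0, hK⟩ := hbound (fun x => φ' x * (|b x| + 1)) (by fun_prop)
    (fun x hx => by simp [hφ'0 x hx])
  let ε : ℕ → ℝ := fun n => 1 / ((n : ℝ) + 1)
  have hε : ∀ n, 0 < ε n := fun n => by positivity
  have hε1 : ∀ n, ε n ≤ 1 := fun n => by
    rw [div_le_one (by positivity)]; linarith [Nat.cast_nonneg (α := ℝ) n]
  have hε0 : Tendsto ε atTop (𝓝 0) := tendsto_one_div_add_atTop_nhds_zero_nat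
  let a : ℕ → ℝ → ℝ := fun n y => |b y| + ε n
  have ha : ∀ n y, 0 < a n y := fun n y => add_pos_of_nonneg_of_pos (abs_nonneg _) (hε n)
  have hac : ∀ n, Continuous (a n) := fun n => by fun_prop
  have hagr : ∀ n x y, |x| ≤ R₀ → a n y ≤ (C + 1 + C * R₀) + (C + 1) * |y - x| := fun n x y hx => by
    have h1 := hgrowth y
    have h2 : |y| ≤ |y - x| + |x| := by simpa using abs_add_le (y - x) x
    have h3 := hε1 n
    have h4 : C * |y| ≤ C * (|y - x| + R₀) := mul_le_mul_of_nonneg_left (by linarith) hC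
    simp only [a]
    nlinarith [abs_nonneg (y - x)]
  have hA : 0 < C + 1 + C * R₀ := by positivity
  have hB : 0 < C + 1 := by positivity
  choose H Y hH hY hHY hYH using fun n => exists_flow_coordinates hA hB (hac n) (ha n)
    (fun y => by simpa using hagr n 0 y (by simpa using hR₀))
  have hHc : ∀ n, Continuous (H n) := fun n =>
    continuous_iff_continuousAt.2 fun x => (hH n x).continuousAt
  have hYc : ∀ n, Continuous (Y n) := fun n =>
    continuous_iff_continuousAt.2 fun x => (hY n x).continuousAt
  -- Within time `T` no trajectory starting in `[-R₀, R₀]` travels as far as `δ`, so all u_n vanish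
  -- outside `[-(R₀ + δ), R₀ + δ]`.
  obtain ⟨δ, hδT, hδ⟩ := (((tendsto_log_growth (C + 1 + C * R₀) hB).eventually_gt_atTop T).and
    (eventually_ge_atTop 0)).exists
  have hescape : ∀ n x s, |s| ≤ T → x ∉ Icc (-(R₀ + δ)) (R₀ + δ) → R₀ < |Y n (H n x + s)| := by
    intro n x s hs hx
    by_contra hcon
    rw [not_lt] at hcon
    -- The trajectory is followed backwards from its endpoint, where the growth bound is available.
    have h1 := abs_flow_sub_lt (s := -s) hA hB hδ (ha n) (hH n) (hHY n)
      (fun y _ => hagr n _ y hcon) (by rw [abs_neg]; linarith)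
    rw [hHY, add_neg_cancel_right, hYH] at h1
    refine hx (abs_le.1 ?_)
    have : |x| ≤ |x - Y n (H n x + s)| + |Y n (H n x + s)| := by
      simpa using abs_add_le (x - Y n (H n x + s)) (Y n (H n x + s))
    linarith
  let Φ : ℕ → ℝ → ℝ := fun n y => φ (Y n y)
  let Ψ : ℕ → ℝ → ℝ := fun n y => φ' (Y n y) * a n (Y n y)
  have hΦ : ∀ n y, HasDerivAt (Φ n) (Ψ n y) y := fun n y => (hφ _).comp y (hY n y)
  have hΦc : ∀ n, Continuous (Φ n) := fun n => hφc.comp (hYc n)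
  have hΨc : ∀ n, Continuous (Ψ n) := fun n => (hφ'c.comp (hYc n)).mul ((hac n).comp (hYc n))
  have hΨ : ∀ n y, |Ψ n y| ≤ K := fun n y => by
    refine le_trans ?_ (hK (Y n y))
    simp only [Ψ, a]
    rw [abs_mul, abs_mul, abs_of_pos (ha n _), abs_of_pos (by positivity : 0 < |b (Y n y)| + 1)]
    exact mul_le_mul_of_nonneg_left (by linarith [hε1 n]) (abs_nonneg _)
  have hΦL : ∀ n y, |Φ n y| ≤ L := fun n y => hL _
  have hΦlip : ∀ n x s, |Φ n (H n x + s) - φ x| ≤ K * |s| := fun n x s => by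
    have := convex_univ.norm_image_sub_le_of_norm_hasDerivWithin_le (f := Φ n) (C := K)
      (fun y _ => (hΦ n y).hasDerivWithinAt) (fun y _ => hΨ n y) (mem_univ (H n x))
      (mem_univ (H n x + s))
    simpa [Φ, hYH] using this
  have hout : ∀ n x s, |s| ≤ T → x ∉ Icc (-(R₀ + δ)) (R₀ + δ) →
      Φ n (H n x + s) = 0 ∧ Ψ n (H n x + s) = 0 := fun n x s hs hx => by
    have := hescape n x s hs hx
    exact ⟨hφ0 _ this, by simp [Ψ, hφ'0 _ this]⟩
  have hba : ∀ n x, |b x * (a n x)⁻¹| ≤ 1 := fun n x => by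
    rw [abs_mul, abs_inv, abs_of_pos (ha n x), ← div_eq_mul_inv, div_le_one (ha n x)]
    simp only [a]; linarith [hε n]
  -- Where g < 0, b equals g; elsewhere η' vanishes.
  have hbη : ∀ n x, |b x * η' n x| ≤ M := fun n x => by
    rcases lt_or_ge (g x) 0 with h | h
    · rw [hsum x, hgf x h, add_zero]; exact hM n x
    · have := hM n x
      rw [(hηpos n x h).2] at this ⊢
      simpa using this
  refine ⟨R₀ + δ, K, 4 * K + M * (2 * L), fun τ hτ => ?_⟩
  have hτt : ∀ t ∈ Icc 0 T, |τ - t| ≤ T := fun t ht =>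
    abs_le.2 ⟨by linarith [hτ.1, ht.2], by linarith [hτ.2, ht.1]⟩
  -- The first term solves ∂_t u + a_n ∂_x u = 0 apart from the cutoff, the second ∂_t u - a_n ∂_x u
  -- = 0; at t = τ both flows are the identity and the sum is φ.
  let u : ℕ → ℝ → ℝ → ℝ := fun n x t =>
    (1 - η n x) * Φ n (H n x + (τ - t)) + η n x * Φ n (H n x + -(τ - t))
  let ut : ℕ → ℝ → ℝ → ℝ := fun n x t =>
    -(1 - η n x) * Ψ n (H n x + (τ - t)) + η n x * Ψ n (H n x + -(τ - t))
  let ux : ℕ → ℝ → ℝ → ℝ := fun n x t =>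
    (-η' n x * Φ n (H n x + (τ - t)) + (1 - η n x) * (Ψ n (H n x + (τ - t)) * (a n x)⁻¹)) +
    (η' n x * Φ n (H n x + -(τ - t)) + η n x * (Ψ n (H n x + -(τ - t)) * (a n x)⁻¹))
  have hainv : ∀ n, Continuous fun x => (a n x)⁻¹ := fun n => (hac n).inv₀ fun x => (ha n x).ne'
  have hu : ∀ n, Continuous fun p : ℝ × ℝ => u n p.1 p.2 := fun n => by
    have := hηc n; have := hΦc n; have := hHc n
    fun_prop
  have hut : ∀ n, Continuous fun p : ℝ × ℝ => ut n p.1 p.2 := fun n => by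
    have := hηc n; have := hΨc n; have := hHc n
    fun_prop
  have hux : ∀ n, Continuous fun p : ℝ × ℝ => ux n p.1 p.2 := fun n => by
    have := hηc n; have := hη'c n; have := hΦc n; have := hΨc n; have := hHc n
    have h1 : Continuous fun p : ℝ × ℝ => (a n p.1)⁻¹ := (hainv n).comp continuous_fst
    simp only [ux]
    fun_prop
  have hdefect : ∀ n x t, ut n x t + b x * ux n x t =
      (1 - η n x) * (b x * (a n x)⁻¹ - 1) * Ψ n (H n x + (τ - t)) +
      η n x * (b x * (a n x)⁻¹ + 1) * Ψ n (H n x + -(τ - t)) +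
      b x * η' n x * (Φ n (H n x + -(τ - t)) - Φ n (H n x + (τ - t))) := fun n x t => by
    simp only [ut, ux]; ring
  have hfrac : ∀ x, b x ≠ 0 → Tendsto (fun n => K * (ε n / (|b x| + ε n))) atTop (𝓝 0) := by
    intro x hx
    have := (hε0.div (hε0.const_add |b x|) (by simpa using hx)).const_mul K
    simpa using this
  refine ⟨u, ut, ux, fun n => ?_, fun n t => ?_, fun n t ht x hx => ?_, fun n t x => ?_,
    fun n => ?_, fun n t ht x hx => ?_, fun n t ht x => ?_, fun t ht x hx => ?_⟩
  · refine ⟨(hu n).continuousOn, (hut n).continuousOn, (hux n).continuousOn, fun x t _ => ?_,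
      fun x t _ => ?_, R₀ + δ, fun x t ht hx => ?_⟩
    · have h1 : HasDerivAt (fun s => H n x + (τ - s)) (-1) t := by
        simpa using ((hasDerivAt_id t).const_sub τ).const_add (H n x)
      have h2 : HasDerivAt (fun s => H n x + -(τ - s)) 1 t := by
        simpa using ((hasDerivAt_id t).const_sub τ).neg.const_add (H n x)
      have h3 := (((hΦ n _).comp t h1).const_mul (1 - η n x)).add
        (((hΦ n _).comp t h2).const_mul (η n x))
      refine HasDerivAt.hasDerivWithinAt (h3.congr_deriv ?_)
      simp only [ut]; ring
    · have h1 := (hΦ n _).comp x ((hH n x).add_const (τ - t))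
      have h2 := (hΦ n _).comp x ((hH n x).add_const (-(τ - t)))
      exact (((hη n x).const_sub 1).mul h1).add ((hη n x).mul h2)
    · have hx' : x ∉ Icc (-(R₀ + δ)) (R₀ + δ) := fun h => absurd (abs_le.2 h) (not_le.2 hx)
      have h := hτt t (Ico_subset_Icc_self ht)
      simp only [u]
      rw [(hout n x _ h hx').1, (hout n x _ (by rwa [abs_neg]) hx').1]
      simp
  · exact (hu n).comp (Continuous.prodMk_left t)
  · have h := hτt t ht
    refine ⟨?_, hφ0 x ?_⟩
    · simp only [u]
      rw [(hout n x _ h hx).1, (hout n x _ (by rwa [abs_neg]) hx).1]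
      simp
    · by_contra hcon
      refine hx (abs_le.1 ?_)
      linarith
  · have h1 := hΦlip n x (τ - t)
    have h2 := hΦlip n x (-(τ - t))
    rw [abs_neg] at h2
    obtain ⟨h3, h4⟩ := hη01 n x
    have h5 : u n x t - φ x = (1 - η n x) * (Φ n (H n x + (τ - t)) - φ x) +
      η n x * (Φ n (H n x + -(τ - t)) - φ x) := by simp only [u]; ring
    rw [h5]
    refine (abs_add_le _ _).trans ?_
    rw [abs_mul, abs_mul, abs_of_nonneg h3, abs_of_nonneg (sub_nonneg.2 h4)]
    calc _ ≤ (1 - η n x) * (K * |τ - t|) + η n x * (K * |τ - t|) :=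
          add_le_add (mul_le_mul_of_nonneg_left h1 (sub_nonneg.2 h4))
            (mul_le_mul_of_nonneg_left h2 h3)
      _ = _ := by ring
  · have h1 : Continuous fun p : ℝ × ℝ => ut n p.2 p.1 + b p.2 * ux n p.2 p.1 :=
      ((hut n).comp continuous_swap).add
        ((hb.comp continuous_snd).mul ((hux n).comp continuous_swap))
    exact h1.measurable
  · have h := hτt t ht
    have h1 := hout n x _ h hx
    have h2 := hout n x (-(τ - t)) (by rwa [abs_neg]) hx
    rw [hdefect, h1.1, h1.2, h2.1, h2.2]
    simp
  · obtain ⟨h3, h4⟩ := hη01 n x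
    have h5 := hba n x
    have h6 : |b x * (a n x)⁻¹ - 1| ≤ 2 := by rw [abs_le] at h5 ⊢; constructor <;> linarith
    have h7 : |b x * (a n x)⁻¹ + 1| ≤ 2 := by rw [abs_le] at h5 ⊢; constructor <;> linarith
    have h8 : |1 - η n x| ≤ 1 := abs_le.2 ⟨by linarith, by linarith⟩
    have h9 : |η n x| ≤ 1 := abs_le.2 ⟨by linarith, h4⟩
    have h10 : |Φ n (H n x + -(τ - t)) - Φ n (H n x + (τ - t))| ≤ 2 * L := by
      refine (abs_sub _ _).trans ?_
      linarith [hΦL n (H n x + -(τ - t)), hΦL n (H n x + (τ - t))]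
    have hM0 : 0 ≤ M := (abs_nonneg _).trans (hbη n x)
    rw [hdefect, Real.norm_eq_abs]
    refine (abs_add_three _ _ _).trans ?_
    simp only [abs_mul _ (Ψ n _), abs_mul _ (Φ n _ - _), abs_mul (1 - η n x), abs_mul (η n x)]
    have e1 := mul_le_mul (mul_le_mul h8 h6 (abs_nonneg _) zero_le_one)
      (hΨ n (H n x + (τ - t))) (abs_nonneg _) (by norm_num)
    have e2 := mul_le_mul (mul_le_mul h9 h7 (abs_nonneg _) zero_le_one)
      (hΨ n (H n x + -(τ - t))) (abs_nonneg _) (by norm_num)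
    have e3 := mul_le_mul (hbη n x) h10 (abs_nonneg _) hM0
    linarith
  · simp_rw [hdefect]
    rcases lt_or_ge (g x) 0 with hgx | hgx
    · have hbx : b x < 0 := by rw [hsum x, hgf x hgx, add_zero]; exact hgx
      refine squeeze_zero_norm' ?_ (hfrac x hbx.ne)
      filter_upwards [hηneg x hgx] with n hn
      have h1 : b x * (a n x)⁻¹ + 1 = ε n / (|b x| + ε n) := by
        have := (ha n x).ne'
        simp only [a] at this ⊢
        field_simp
        rw [abs_of_neg hbx]; ring
      rw [hn.1, hn.2, h1]
      simp only [sub_self, zero_mul, mul_zero, add_zero, zero_add, one_mul]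
      rw [norm_mul, Real.norm_of_nonneg (div_nonneg (hε n).le (ha n x).le), mul_comm]
      exact mul_le_mul_of_nonneg_right (hΨ n _) (div_nonneg (hε n).le (ha n x).le)
    · have hη0 := fun n => hηpos n x hgx
      simp only [fun n => (hη0 n).1, fun n => (hη0 n).2, sub_zero, zero_mul, mul_zero, add_zero,
        one_mul]
      have hbx : 0 ≤ b x := by rw [hsum x]; exact add_nonneg hgx (hf x)
      rcases hbx.lt_or_eq with hbx | hbx
      · refine squeeze_zero_norm (fun n => ?_) (hfrac x hbx.ne')
        have h1 : b x * (a n x)⁻¹ - 1 = -(ε n / (|b x| + ε n)) := by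
          have := (ha n x).ne'
          simp only [a] at this ⊢
          field_simp
          rw [abs_of_pos hbx]; ring
        rw [h1, norm_mul, norm_neg, Real.norm_of_nonneg (div_nonneg (hε n).le (ha n x).le), mul_comm]
        exact mul_le_mul_of_nonneg_right (hΨ n _) (div_nonneg (hε n).le (ha n x).le)
      -- Here 0 = b x = g x + f x with both terms nonnegative, so both vanish; being off the
      -- frontier, x is interior to Z_f.
      · have hfx : f x = 0 := by linarith [hsum x, hf x]
        have hgx0 : g x = 0 := by linarith [hsum x]
        have hint : x ∈ interior {x | f x = 0} := by
          by_contra h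
          exact hx ⟨subset_closure hfx, h⟩
        obtain ⟨r, hr, hrs⟩ := Metric.isOpen_iff.1 isOpen_interior x hint
        have hflow : Tendsto (fun n => Y n (H n x + (τ - t))) atTop (𝓝 x) := by
          rw [Metric.tendsto_nhds]
          intro ρ hρ
          have hmin : 0 < min ρ (r / 2) := lt_min hρ (by linarith)
          -- `Λ + 1` serves as a slope because `Λ` may be 0; the radius at most r / 2 keeps the
          -- closed ball inside Z_f, where b = g.
          have hB' : (0 : ℝ) < Λ + 1 := by positivity
          filter_upwards [(tendsto_escape_time hε hε0 hB' hmin).eventually_gt_atTop T] with n hn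
          have := abs_flow_sub_lt (x := x) (hε n) hB' hmin.le (ha n) (hH n) (hHY n) (fun y hy => ?_)
            ((hτt t ht).trans_lt hn)
          · exact this.trans_le (min_le_left _ _)
          · have hy' : y ∈ {x | f x = 0} := interior_subset (hrs (by
              rw [Metric.mem_ball, Real.dist_eq]
              linarith [min_le_right ρ (r / 2)]))
            have h1 := hg.dist_le_mul y x
            rw [Real.dist_eq, Real.dist_eq, hgx0, sub_zero] at h1
            simp only [a]
            rw [hsum y, show f y = 0 from hy', add_zero]
            linarith [abs_nonneg (y - x)]
        have h1 : Tendsto (fun n => Ψ n (H n x + (τ - t))) atTop (𝓝 (φ' x * (|b x| + 0))) :=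
          ((hφ'c.tendsto x).comp hflow).mul ((((hb.tendsto x).comp hflow).abs).add hε0)
        rw [← hbx] at h1 ⊢
        simpa using h1.neg

/-! ### Duality and uniqueness -/

namespace IsCauchySolution

variable {T : ℝ} {b : ℝ → ℝ} {ν : LocallyBoundedMeasure} {μ : ℝ → LocallyBoundedMeasure}

theorem enorm_integral_sub_le (h : IsCauchySolution T b ν μ) {u ut ux : ℝ → ℝ → ℝ}
    (hu : IsTestFunction T u ut ux) : ∀ᵐ t ∂(volume.restrict (Icc 0 T)),
      ‖(μ t).integral (fun x => u x t) - ν.integral (fun x => u x 0)‖ₑ ≤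
        ∫⁻ s in Icc 0 T, ∫⁻ x, ‖ut x s + b x * ux x s‖ₑ ∂(μ s).variation := by
  filter_upwards [h.weak_equation u ut ux hu, ae_restrict_mem measurableSet_Icc] with t ht htT
  rw [ht, add_sub_cancel_left, intervalIntegral.integral_of_le htT.1]
  refine (enorm_integral_le_lintegral_enorm _).trans ?_
  refine (lintegral_mono_set (Ioc_subset_Icc_self.trans (Icc_subset_Icc_right htT.2))).trans ?_
  exact lintegral_mono fun s => (μ s).enorm_integral_le _

end IsCauchySolution

/-- The weak equation holds only for almost every t, with an exceptional set depending on the test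
function and hence on τ, so t = τ cannot be inserted. Instead τ runs over the rationals, |u_n - φ| ≤
K |τ - t| controls the mismatch, and τ → t at the end. -/
theorem integral_eq_of_isCauchySolution {T : ℝ} {b g f : ℝ → ℝ} {C : ℝ} {Λ : ℝ≥0}
    (hb : Continuous b) (hgrowth : ∀ x, |b x| ≤ C + C * |x|)
    (hsum : ∀ x, b x = g x + f x) (hf : ∀ x, 0 ≤ f x) (hg : LipschitzWith Λ g)
    (hgf : ∀ x, g x < 0 → f x = 0)
    {ν : LocallyBoundedMeasure} {μ₁ μ₂ : ℝ → LocallyBoundedMeasure}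
    (h₁ : IsCauchySolution T b ν μ₁) (h₂ : IsCauchySolution T b ν μ₂)
    (hZ₁ : ∀ᵐ t ∂(volume.restrict (Icc 0 T)), (μ₁ t).variation (frontier {x | f x = 0}) = 0)
    (hZ₂ : ∀ᵐ t ∂(volume.restrict (Icc 0 T)), (μ₂ t).variation (frontier {x | f x = 0}) = 0)
    {φ φ' : ℝ → ℝ} (hφ : ∀ x, HasDerivAt φ (φ' x) x)
    (hφ'c : Continuous φ') {R₀ : ℝ} (hR₀ : 0 ≤ R₀) (hφ0 : ∀ x, R₀ < |x| → φ x = 0) :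
    ∀ᵐ t ∂(volume.restrict (Icc 0 T)), (μ₁ t).integral φ = (μ₂ t).integral φ := by
  obtain ⟨R, K, D, hdual⟩ := exists_approximate_backward_solutions hb hgrowth hsum hf hg hgf hφ
    hφ'c hR₀ hφ0
  have hφc : Continuous φ := continuous_iff_continuousAt.2 fun x => (hφ x).continuousAt
  have hsub : ∀ (m : LocallyBoundedMeasure) (v : ℝ → ℝ) (c : ℝ), Continuous v →
      (∀ x, x ∉ Icc (-R) R → v x = 0 ∧ φ x = 0) → (∀ x, |v x - φ x| ≤ c) →
      ‖m.integral v - m.integral φ‖ₑ ≤ ENNReal.ofReal c * m.variation (Icc (-R) R) := by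
    intro m v c hv h0 hc
    have hint : ∀ w : ℝ → ℝ, Continuous w → (∀ x, x ∉ Icc (-R) R → w x = 0) →
        Integrable w m.variation := fun w hw hw0 =>
      hw.integrable_of_hasCompactSupport (HasCompactSupport.intro isCompact_Icc hw0)
    rw [m.integral_sub (hint v hv fun x hx => (h0 x hx).1) (hint φ hφc fun x hx => (h0 x hx).2)]
    refine (m.enorm_integral_le _).trans ?_
    rw [← setLIntegral_const, ← lintegral_indicator measurableSet_Icc]
    refine lintegral_mono fun x => ?_
    by_cases hx : x ∈ Icc (-R) R
    · rw [indicator_of_mem hx, ← ofReal_norm]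
      exact ENNReal.ofReal_le_ofReal (hc x)
    · rw [indicator_of_notMem hx, (h0 x hx).1, (h0 x hx).2]
      simp
  have hτ : ∀ q : ℚ, (q : ℝ) ∈ Icc 0 T → ∀ᵐ t ∂(volume.restrict (Icc 0 T)),
      ‖(μ₁ t).integral φ - (μ₂ t).integral φ‖ₑ ≤ ENNReal.ofReal (K * |(q : ℝ) - t|) *
        ((μ₁ t).variation (Icc (-R) R) + (μ₂ t).variation (Icc (-R) R)) := by
    intro q hq
    obtain ⟨u, ut, ux, htest, huc, hu0, huφ, hem, he0, heD, helim⟩ := hdual q hq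
    have hE : ∀ μ : ℝ → LocallyBoundedMeasure, IsCauchySolution T b ν μ →
        (∀ᵐ t ∂(volume.restrict (Icc 0 T)), (μ t).variation (frontier {x | f x = 0}) = 0) →
        Tendsto (fun n => ∫⁻ s in Icc 0 T, ∫⁻ x, ‖ut n x s + b x * ux n x s‖ₑ ∂(μ s).variation)
          atTop (𝓝 0) := by
      intro μ h hZ
      refine h.family.tendsto_lintegral_zero (e := fun n s x => ut n x s + b x * ux n x s)
        hem heD he0 ?_
      filter_upwards [hZ, ae_restrict_mem measurableSet_Icc] with s hs hsT
      have : ∀ᵐ x ∂(μ s).variation, x ∉ frontier {x | f x = 0} := measure_eq_zero_iff_ae_notMem.1 hs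
      filter_upwards [this] with x hx using helim s hsT x hx
    have hall₁ := ae_all_iff.2 fun n => h₁.enorm_integral_sub_le (htest n)
    have hall₂ := ae_all_iff.2 fun n => h₂.enorm_integral_sub_le (htest n)
    filter_upwards [hall₁, hall₂, ae_restrict_mem measurableSet_Icc] with t ht₁ ht₂ htT
    have hlim := ((hE μ₁ h₁ hZ₁).add (hE μ₂ h₂ hZ₂)).add_const
      (ENNReal.ofReal (K * |(q : ℝ) - t|) *
        ((μ₁ t).variation (Icc (-R) R) + (μ₂ t).variation (Icc (-R) R)))
    rw [add_zero, zero_add] at hlim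
    refine ge_of_tendsto' hlim fun n => ?_
    have e1 := hsub (μ₁ t) _ _ (huc n t) (hu0 n t htT) (huφ n t)
    have e2 := hsub (μ₂ t) _ _ (huc n t) (hu0 n t htT) (huφ n t)
    rw [enorm_sub_rev] at e1
    -- Here v is the common initial term: the first two differences are bounded by the defects, the
    -- last two by the distance from u_n to φ.
    have hsplit : ∀ p₁ p₂ v₁ v₂ v : ℝ, p₁ - p₂ = ((v₁ - v) - (v₂ - v)) + ((p₁ - v₁) + (v₂ - p₂)) := by
      intros; ring
    rw [hsplit _ _ ((μ₁ t).integral fun x => u n x t) ((μ₂ t).integral fun x => u n x t)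
      (ν.integral fun x => u n x 0), mul_add]
    exact (enorm_add_le _ _).trans (add_le_add (enorm_sub_le.trans (add_le_add (ht₁ n) (ht₂ n)))
      ((enorm_add_le _ _).trans (add_le_add e1 e2)))
  have hτ' : ∀ᵐ t ∂(volume.restrict (Icc 0 T)), ∀ q : ℚ, (q : ℝ) ∈ Icc 0 T →
      ‖(μ₁ t).integral φ - (μ₂ t).integral φ‖ₑ ≤ ENNReal.ofReal (K * |(q : ℝ) - t|) *
        ((μ₁ t).variation (Icc (-R) R) + (μ₂ t).variation (Icc (-R) R)) :=
    ae_all_iff.2 fun q => by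
      by_cases hq : (q : ℝ) ∈ Icc 0 T
      · filter_upwards [hτ q hq] with t ht _ using ht
      · exact ae_of_all _ fun t h => absurd h hq
  have hmem : ∀ᵐ t ∂(volume.restrict (Icc 0 T)), t ∈ Ioo 0 T := by
    rw [← Measure.restrict_congr_set Ioo_ae_eq_Icc]
    exact ae_restrict_mem measurableSet_Ioo
  filter_upwards [hτ', hmem] with t ht htT
  have hV : (μ₁ t).variation (Icc (-R) R) + (μ₂ t).variation (Icc (-R) R) ≠ ∞ :=
    ENNReal.add_ne_top.2 ⟨isCompact_Icc.measure_lt_top.ne, isCompact_Icc.measure_lt_top.ne⟩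
  have hclosed : IsClosed {τ : ℝ | ‖(μ₁ t).integral φ - (μ₂ t).integral φ‖ₑ ≤
      ENNReal.ofReal (K * |τ - t|) *
        ((μ₁ t).variation (Icc (-R) R) + (μ₂ t).variation (Icc (-R) R))} := by
    refine isClosed_le continuous_const (ENNReal.continuous_mul_const hV |>.comp ?_)
    exact ENNReal.continuous_ofReal.comp (by fun_prop)
  -- The estimate is closed in τ and holds at the rationals of (0, T), so it holds at τ = t, where
  -- its right side is 0.
  have hclos : t ∈ closure (Ioo 0 T ∩ range ((↑) : ℚ → ℝ)) :=
    (Rat.denseRange_cast (𝕜 := ℝ)).open_subset_closure_inter isOpen_Ioo htT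
  have := closure_minimal (t := {τ : ℝ | ‖(μ₁ t).integral φ - (μ₂ t).integral φ‖ₑ ≤
      ENNReal.ofReal (K * |τ - t|) *
        ((μ₁ t).variation (Icc (-R) R) + (μ₂ t).variation (Icc (-R) R))}) (by
      rintro _ ⟨hq, q, rfl⟩
      exact ht q (Ioo_subset_Icc_self hq)) hclosed hclos
  simp only [mem_ofPred_eq, sub_self, abs_zero, mul_zero, ENNReal.ofReal_zero, zero_mul,
    nonpos_iff_eq_zero, enorm_eq_zero] at this
  exact sub_eq_zero.1 this

theorem corollary2 (T : ℝ) (hT : 0 < T) (b g f : ℝ → ℝ) (C : ℝ) (Λ : ℝ≥0)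
    (hb : Continuous b) (hgrowth : ∀ x, |b x| ≤ C + C * |x|)
    (hsum : ∀ x, b x = g x + f x) (hf : ∀ x, 0 ≤ f x) (hg : LipschitzWith Λ g)
    (hgf : ∀ x, g x < 0 → f x = 0)
    (ν : LocallyBoundedMeasure) (μ₁ μ₂ : ℝ → LocallyBoundedMeasure)
    (h₁ : IsCauchySolution T b ν μ₁) (h₂ : IsCauchySolution T b ν μ₂)
    (hZ₁ : ∀ᵐ t ∂(volume.restrict (Icc 0 T)), (μ₁ t).variation (frontier {x | f x = 0}) = 0)
    (hZ₂ : ∀ᵐ t ∂(volume.restrict (Icc 0 T)), (μ₂ t).variation (frontier {x | f x = 0}) = 0) :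
    ∀ᵐ t ∂(volume.restrict (Icc 0 T)), μ₁ t = μ₂ t := by
  have key : ∀ (p q : ℚ) (k : ℕ), ∀ᵐ t ∂(volume.restrict (Icc 0 T)),
      (μ₁ t).integral (fun x => Real.smoothTransition (k * (x - p)) *
        Real.smoothTransition (k * (q - x))) =
      (μ₂ t).integral fun x => Real.smoothTransition (k * (x - p)) *
        Real.smoothTransition (k * (q - x)) := by
    intro p q k
    have hsm : ContDiff ℝ 1 fun x : ℝ => Real.smoothTransition (k * (x - p)) *
        Real.smoothTransition (k * (q - x)) := by
      have h : ContDiff ℝ 1 Real.smoothTransition := Real.smoothTransition.contDiff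
      exact (h.comp (by fun_prop)).mul (h.comp (by fun_prop))
    refine integral_eq_of_isCauchySolution hb hgrowth hsum hf hg hgf h₁ h₂ hZ₁ hZ₂
      (fun x => (hsm.differentiable (by simp) x).hasDerivAt) (hsm.continuous_deriv le_rfl)
      (R₀ := |(p : ℝ)| + |(q : ℝ)|) (by positivity) fun x hx => ?_
    rcases le_or_gt x p with h | h
    · rw [Real.smoothTransition.zero_of_nonpos (x := k * (x - p))
        (mul_nonpos_of_nonneg_of_nonpos (by positivity) (by linarith)), zero_mul]
    · rw [Real.smoothTransition.zero_of_nonpos (x := k * (q - x))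
        (mul_nonpos_of_nonneg_of_nonpos (by positivity) ?_), mul_zero]
      by_contra hcon
      rcases abs_cases x with hc | hc <;>
        linarith [neg_abs_le (p : ℝ), le_abs_self (q : ℝ), abs_nonneg (p : ℝ), abs_nonneg (q : ℝ)]
  -- Countably many test functions share one exceptional null set of times.
  have hall := ae_all_iff.2 fun p => ae_all_iff.2 fun q => ae_all_iff.2 fun k => key p q k
  filter_upwards [hall] with t ht
  exact LocallyBoundedMeasure.ext_of_integral_eq ht
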